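/- **Conventions.** A pencil of plane curves of degree $d$ is a line in the projective space of homogeneous polynomials of degree $d$ in $\mathbb{C}[x,y,z]$ (a two-dimensional space of forms); its members are called fibers, and its base $\mathcal X\subset\mathbb{CP}^2$ is the set of common zeros of its fibers. We assume that there are no fixed components, i.e. that $\mathcal X$ is finite. A fiber is completely reducible if it is a product $\prod_i\alpha_i^{m_i}$ of powers of linear forms. The pencil is connected if, in the blow-up of $\mathbb{CP}^2$ at the points of $\mathcal X$, the proper transform of every fiber is connected. (When the rational map $\mathbb{CP}^2\dashrightarrow\mathbb{CP}^1$ of the pencil lifts to a regular map on the blow-up, these are the fibers of the lift.) A pencil of Ceva type is a connected pencil without fixed components in which three or more fibers are completely reducible. A $(k,d)$-multinet on a finite line arrangement $\mathcal L$ in $\mathbb{CP}^2$ with multiplicities $m:\mathcal L\to\mathbb Z_{>0}$ consists of a partition of $\mathcal L$ into $k\ge 3$ nonempty classes $\mathcal L_1,\dots,\mathcal L_k$ and a set $\mathcal X$ (the base locus) of points, each lying on at least three lines of $\mathcal L$, such that: (i) $\sum_{\ell\in\mathcal L_i}m(\ell)=d$ for every $i$; (ii) if $\ell\in\mathcal L_i$,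 $\ell'\in\mathcal L_j$ and $i\ne j$, then $\ell\cap\ell'\in\mathcal X$; (iii) for each $p\in\mathcal X$, the number $\sum_{\ell\in\mathcal L_i,\,p\in\ell}m(\ell)$ does not depend on $i$; (iv) any two lines $\ell,\ell'$ of the same class $\mathcal L_i$ are joined by a sequence $\ell=\ell_0,\ell_1,\dots,\ell_r=\ell'$ of lines of $\mathcal L_i$ such that consecutive lines meet at a point outside $\mathcal X$. By convention the multiplicities $m(\ell)$, $\ell\in\mathcal L$, of a multinet are mutually relatively prime (their greatest common divisor is $1$). **Proposition 3.6.** Let $\pi$ be a pencil of Ceva type of degree $d$, with base $\mathcal X$. If $d\ge 2$, then $\pi$ has only finitely many completely reducible fibers. Let $C_1,\dots,C_k$, $k\ge 3$, be finitely many distinct completely reducible fibers of $\pi$ (for $d\ge 2$ one may take all of them). Let $\mathcal L_i$ be the set of lines that are components of $C_i$, let $\mathcal L=\mathcal L_1\cup\dots\cup\mathcal L_k$, and for $\ell\in\mathcal L_i$ let $m(\ell)$ be the exponent of the linear form of $\ell$ in $C_i$. Then $m$ is well defined, and the partition $\mathcal L=\mathcal L_1\cup\dots\cup\mathcal L_k$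 together with the base locus $\mathcal X$ is a $(k,d)$-multinet on $(\mathcal L,m)$; in particular, the multiplicities $m(\ell)$ are mutually relatively prime. -/

import Mathlib

open scoped LinearAlgebra.Projectivization

noncomputable section

namespace CevaPencil

/-! ### Points, lines and curves in the complex projective plane -/

/-- Points `[x : y : z]` of the complex projective plane. -/
abbrev Point : Type := ℙ ℂ (Fin 3 → ℂ)

/-- Lines of the complex projective plane, as points `[a : b : c]` of the dual plane:
the line with equation `a x + b y + c z = 0`. -/
abbrev Line : Type := ℙ ℂ (Fin 3 → ℂ)

/-- The classical topology of the complex projective plane (and of its dual plane):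
the quotient topology from the nonzero vectors of `ℂ³`. -/
instance instTopologicalSpacePoint : TopologicalSpace (ℙ ℂ (Fin 3 → ℂ)) :=
  TopologicalSpace.coinduced (Projectivization.mk' ℂ) inferInstance

/-- The set of points of a line. -/
def linePoints (l : Line) : Set Point := {p | p.orthogonal l}

/-- The linear form `a x + b y + c z` defining a line (well defined up to a nonzero scalar). -/
def linForm (l : Line) : MvPolynomial (Fin 3) ℂ :=
  ∑ i, MvPolynomial.C (l.rep i) * MvPolynomial.X i

/-- The set of points of the plane curve defined by a homogeneous polynomial. -/
def zeroLocus (F : MvPolynomial (Fin 3) ℂ) : Set Point :=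
  {p | MvPolynomial.eval p.rep F = 0}

/-- A completely reducible curve: a product `∏ αᵢ ^ mᵢ` of positive powers of
nonzero linear forms. -/
def IsCompletelyReducible (F : MvPolynomial (Fin 3) ℂ) : Prop :=
  ∃ (q : ℕ) (α : Fin q → MvPolynomial (Fin 3) ℂ) (m : Fin q → ℕ),
    (∀ i, (α i).IsHomogeneous 1 ∧ α i ≠ 0 ∧ 0 < m i) ∧ F = ∏ i, α i ^ m i

/-! ### Blow-up and proper transforms -/

/-- The blow-up of the plane at a finite set `X` of points: a point of it is a point `q` of the
plane together with, for each `p ∈ X`, a line through `p` and `q`. (Away from `X` these lines are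
determined by `q`; over `p ∈ X` the line attached to `p` is an arbitrary line through `p`.)
The projection to the first component is the blow-down map. -/
def blowUp (X : Set Point) : Set (Point × (X → Line)) :=
  {s | ∀ p : X, s.1 ∈ linePoints (s.2 p) ∧ (p : Point) ∈ linePoints (s.2 p)}

/-- The proper transform of the curve `F = 0` in the blow-up at `X`: the closure of the part of
its preimage that lies outside the exceptional curves. -/
def properTransform (X : Set Point) (F : MvPolynomial (Fin 3) ℂ) : Set (Point × (X → Line)) :=
  closure {s | s ∈ blowUp X ∧ s.1 ∉ X ∧ s.1 ∈ zeroLocus F}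

/-! ### Pencils -/

/-- The common zeros of all the curves of a linear system. -/
def baseLocus (W : Submodule ℂ (MvPolynomial (Fin 3) ℂ)) : Set Point :=
  {p | ∀ F ∈ W, p ∈ zeroLocus F}

/-- A pencil of plane curves of degree `d` without fixed components: a line in the projective
space of homogeneous polynomials of degree `d` in three variables, that is, a two-dimensional
linear space of such polynomials, whose base is finite. -/
structure Pencil (d : ℕ) where
  space : Submodule ℂ (MvPolynomial (Fin 3) ℂ)
  homogeneous : space ≤ MvPolynomial.homogeneousSubmodule (Fin 3) ℂ d
  finrank_space : Module.finrank ℂ space = 2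
  finite_base : (baseLocus space).Finite

namespace Pencil

variable {d : ℕ} (P : Pencil d)

/-- The base of the pencil. -/
def base : Set Point := baseLocus P.space

/-- The parameter space of the fibers of the pencil, a projective line. -/
abbrev Param : Type := ℙ ℂ P.space

/-- The fiber with the given parameter, as a nonzero homogeneous polynomial (well defined up to
a nonzero scalar). -/
def fiber (t : P.Param) : MvPolynomial (Fin 3) ℂ := (t.rep : P.space)

/-- The (parameters of) completely reducible fibers. -/
def reducibleFibers : Set P.Param := {t | IsCompletelyReducible (P.fiber t)}

/-- The lines that are components of a fiber. -/
def fiberLines (t : P.Param) : Set Line := {l | linForm l ∣ P.fiber t}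

/-- The pencil is connected: in the blow-up of the plane at the base, the proper transform of
every fiber is connected. When the rational map given by the pencil lifts to a regular map from
the blow-up to the projective line (as it does as soon as there are three completely reducible
fibers), these proper transforms are the fibers of the lifted map. -/
def IsConnectedPencil : Prop :=
  ∀ t : P.Param, IsConnected (properTransform P.base (P.fiber t))

/-- A pencil of Ceva type: a connected pencil without fixed components in which three or more
fibers are completely reducible. -/
def IsCeva : Prop :=
  P.IsConnectedPencil ∧ 3 ≤ P.reducibleFibers.encard

end Pencil

/-! ### Multinets -/

/-- A multi-arrangement: a finite set of lines with positive integer multiplicities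
(the values of `mult` off `lines` are irrelevant). -/
structure MultiArrangement where
  lines : Set Line
  finite_lines : lines.Finite
  mult : Line → ℕ
  mult_pos : ∀ l ∈ lines, 0 < mult l

/-- `(cls, X)` is a weak `(k, d)`-multinet on `A`: the sets `cls i` are the `k ≥ 3` classes of a
partition of the lines of `A`, and `X` is a set of multiple points of `A` (points on at least
three of the lines), subject to the three numerical and incidence conditions. -/
structure IsWeakMultinet {ι : Type*} (A : MultiArrangement) (k d : ℕ)
    (cls : ι → Set Line) (X : Set Point) : Prop where
  card_classes : Nat.card ι = k
  three_le : 3 ≤ k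
  nonempty : ∀ i, (cls i).Nonempty
  disjoint : ∀ i j, i ≠ j → Disjoint (cls i) (cls j)
  union : ⋃ i, cls i = A.lines
  multiple : ∀ p ∈ X, 3 ≤ {l ∈ A.lines | p ∈ linePoints l}.encard
  degree : ∀ i, ∑ᶠ l ∈ cls i, A.mult l = d
  inter_mem : ∀ i j, i ≠ j → ∀ l ∈ cls i, ∀ l' ∈ cls j,
    ∀ p, p ∈ linePoints l → p ∈ linePoints l' → p ∈ X
  balanced : ∀ p ∈ X, ∃ n : ℕ, ∀ i, ∑ᶠ l ∈ {l ∈ cls i | p ∈ linePoints l}, A.mult l = n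

/-- A multinet: a weak multinet such that any two lines of the same class are joined by a sequence
of lines of that class in which consecutive lines meet outside `X`. -/
structure IsMultinet {ι : Type*} (A : MultiArrangement) (k d : ℕ)
    (cls : ι → Set Line) (X : Set Point) : Prop extends IsWeakMultinet A k d cls X where
  chain : ∀ i, ∀ l ∈ cls i, ∀ l' ∈ cls i,
    Relation.ReflTransGen
      (fun a b => b ∈ cls i ∧ ∃ p, p ∈ linePoints a ∧ p ∈ linePoints b ∧ p ∉ X) l l'

end CevaPencil

end

noncomputable section

namespace CevaPencil

open MvPolynomial

/-! ### Points, lines and linear forms -/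

/-! Two distinct fibers span the pencil, so their common zeros are base points. As the base is
finite, the classes are disjoint, and lines of different classes meet in the base. Unique
factorization gives the degree condition.

Balance (`multiplicity_eq_at_base`): restrict a relation `F_r = a F_s + b F_t` to a line of `F_r`
through the base point. The left side dies, so `F_s` and `F_t` restrict to proportional polynomials,
with the same order of vanishing.

Chains (`fiberLines_subset_of_isConnected`): in the blow-up, two lines that meet only in the base
have disjoint proper transforms. A splitting of the components into two nonempty parts that meet
only in the base would therefore disconnect the fiber.

Coprimality (`eq_one_of_dvd_multiplicity`): if `c > 1` divides all multiplicities of `F_s` and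
`F_t`, then `F_r = x ^ c - y ^ c` has the factor `x - y`. This factor and its cofactor meet only in
the base, contradicting connectedness.

Finiteness (`finite_reducibleFibers`): only finitely many lines carry two base points. Three
completely reducible fibers free of such lines would have a common base point through which all
lines of two of them pass. By connectedness each of these two is a `d`-th power up to a constant, so
coprimality forces `d = 1`. -/

theorem mem_linePoints_iff_dotProduct (p : Point) (l : Line) :
    p ∈ linePoints l ↔ p.rep ⬝ᵥ l.rep = 0 := by
  conv_lhs => rw [← p.mk_rep, ← l.mk_rep]
  exact Projectivization.orthogonal_mk _ _

theorem eval_linForm (l : Line) (v : Fin 3 → ℂ) : eval v (linForm l) = v ⬝ᵥ l.rep := by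
  simp [linForm, dotProduct, mul_comm]

theorem mem_linePoints_iff_eval (p : Point) (l : Line) :
    p ∈ linePoints l ↔ eval p.rep (linForm l) = 0 := by
  rw [mem_linePoints_iff_dotProduct, eval_linForm]

theorem eq_or_eq_of_mem_linePoints {p q : Point} {l m : Line} (hpl : p ∈ linePoints l)
    (hql : q ∈ linePoints l) (hpm : p ∈ linePoints m) (hqm : q ∈ linePoints m) :
    p = q ∨ l = m :=
  Configuration.ofField.eq_or_eq_of_orthogonal hpl hql hpm hqm

theorem exists_mem_linePoints_inter {l m : Line} (h : l ≠ m) :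
    ∃ p, p ∈ linePoints l ∧ p ∈ linePoints m := by
  classical
  exact ⟨_, Projectivization.cross_orthogonal_left h, Projectivization.cross_orthogonal_right h⟩

theorem exists_linearIndependent_pair_orthogonal (a : Fin 3 → ℂ) :
    ∃ v w : Fin 3 → ℂ, LinearIndependent ℂ ![v, w] ∧ v ⬝ᵥ a = 0 ∧ w ⬝ᵥ a = 0 := by
  let f : (Fin 3 → ℂ) →ₗ[ℂ] ℂ := dotProductBilin ℂ ℂ a
  have h1 : 1 < Module.finrank ℂ (LinearMap.ker f) := by
    have h2 := f.finrank_range_add_finrank_ker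
    have h3 : Module.finrank ℂ (LinearMap.range f) ≤ 1 := by
      simpa using (LinearMap.range f).finrank_le
    simp at h2
    omega
  obtain ⟨v, hv⟩ := @exists_ne (LinearMap.ker f)
    (Module.nontrivial_of_finrank_pos (R := ℂ) (by omega)) 0
  obtain ⟨w, hw⟩ := exists_linearIndependent_pair_of_one_lt_finrank h1 hv
  refine ⟨v, w, ?_, ?_, ?_⟩
  · have := hw.map' (LinearMap.ker f).subtype (by simp)
    have e : ![(v : Fin 3 → ℂ), w] = (LinearMap.ker f).subtype ∘ ![v, w] := by
      ext i
      fin_cases i <;> rfl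
    rwa [e]
  · rw [dotProduct_comm]; exact v.2
  · rw [dotProduct_comm]; exact w.2

theorem infinite_linePoints (l : Line) : (linePoints l).Infinite := by
  obtain ⟨v, w, hvw, hv, hw⟩ := exists_linearIndependent_pair_orthogonal l.rep
  rw [LinearIndependent.pair_iff] at hvw
  have hne : ∀ s : ℂ, v + s • w ≠ 0 := fun s h => by
    simpa using (hvw 1 s (by simpa using h)).1
  refine Set.infinite_of_injective_forall_mem (α := ℂ)
    (f := fun s : ℂ => Projectivization.mk ℂ (v + s • w) (hne s)) (fun s t h => ?_) fun s => ?_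
  · obtain ⟨a, ha⟩ := (Projectivization.mk_eq_mk_iff' ℂ _ _ _ _).1 h
    have h1 := hvw (a - 1) (a * t - s) (by
      have : (a - 1) • v + (a * t - s) • w = a • (v + t • w) - (v + s • w) := by module
      rw [this, ha, sub_self])
    have ha1 : a = 1 := by linear_combination h1.1
    have := h1.2
    rw [ha1] at this
    linear_combination -this
  · change Projectivization.orthogonal (Projectivization.mk ℂ (v + s • w) (hne s)) l
    rw [← l.mk_rep, Projectivization.orthogonal_mk, add_dotProduct, smul_dotProduct, hv, hw]
    simp

theorem exists_mem_linePoints_notMem (l : Line) {X : Set Point} (hX : X.Finite) :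
    ∃ p ∈ linePoints l, p ∉ X :=
  ((infinite_linePoints l).sdiff hX).nonempty

theorem linePoints_subset_iff {l m : Line} : linePoints l ⊆ linePoints m ↔ l = m := by
  refine ⟨fun h => ?_, fun h => h ▸ subset_rfl⟩
  obtain ⟨p, hp, q, hq, hpq⟩ := (infinite_linePoints l).nontrivial
  exact (eq_or_eq_of_mem_linePoints hp hq (h hp) (h hq)).resolve_left hpq

theorem eval_eq_zero_of_linForm_dvd {F : MvPolynomial (Fin 3) ℂ} {l : Line} (h : linForm l ∣ F)
    {p : Point} (hp : p ∈ linePoints l) : eval p.rep F = 0 := by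
  obtain ⟨G, rfl⟩ := h
  rw [map_mul, (mem_linePoints_iff_eval p l).1 hp, zero_mul]

theorem linForm_dvd_linForm {l m : Line} : linForm l ∣ linForm m ↔ l = m := by
  refine ⟨fun h => ?_, fun h => h ▸ dvd_rfl⟩
  exact linePoints_subset_iff.1 fun p hp =>
    (mem_linePoints_iff_eval p m).2 (eval_eq_zero_of_linForm_dvd h hp)

theorem isHomogeneous_linForm (l : Line) : (linForm l).IsHomogeneous 1 :=
  IsHomogeneous.sum _ _ _ fun i _ => by simpa using isHomogeneous_C_mul_X (l.rep i) i

theorem linForm_ne_zero (l : Line) : linForm l ≠ 0 := by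
  intro h
  obtain ⟨q, hq⟩ := Projectivization.exists_not_orthogonal_self l
  exact hq ((mem_linePoints_iff_eval q l).2 (by simp [h]))

theorem prime_linForm (l : Line) : Prime (linForm l) := by
  rw [← irreducible_iff_prime]
  refine irreducible_of_totalDegree_eq_one
    ((isHomogeneous_linForm l).totalDegree (linForm_ne_zero l)) fun x hx => ?_
  rw [isUnit_iff_ne_zero]
  rintro rfl
  exact linForm_ne_zero l (MvPolynomial.ext _ _ fun i => by simpa using hx i)

theorem exists_eq_C_mul_linForm {α : MvPolynomial (Fin 3) ℂ} (h : α.IsHomogeneous 1)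
    (h0 : α ≠ 0) : ∃ (c : ℂ) (l : Line), c ≠ 0 ∧ α = C c * linForm l := by
  have h1 : α ∈ homogeneousSubmodule (Fin 3) ℂ 1 := h
  rw [homogeneousSubmodule_one_eq_span_X, Submodule.mem_span_range_iff_exists_fun] at h1
  obtain ⟨v, rfl⟩ := h1
  have hv : v ≠ 0 := by
    rintro rfl
    simp at h0
  obtain ⟨a, ha⟩ := Projectivization.exists_smul_eq_mk_rep ℂ v hv
  refine ⟨(a⁻¹ : ℂˣ), Projectivization.mk ℂ v hv, Units.ne_zero _, ?_⟩
  have hr : ∀ i, (Projectivization.mk ℂ v hv).rep i = a * v i := fun i => by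
    rw [← ha]; rfl
  simp only [linForm, hr, Finset.mul_sum, ← mul_assoc, ← C_mul, smul_eq_C_mul]
  simp

/-! ### Products of linear forms -/

theorem IsCompletelyReducible.exists_multiset {F : MvPolynomial (Fin 3) ℂ}
    (h : IsCompletelyReducible F) :
    ∃ (a : ℂ) (M : Multiset Line), a ≠ 0 ∧ F = C a * (M.map linForm).prod := by
  obtain ⟨q, α, m, hα, rfl⟩ := h
  refine Finset.prod_induction _
    (fun F => ∃ (a : ℂ) (M : Multiset Line), a ≠ 0 ∧ F = C a * (M.map linForm).prod)
    ?_ ⟨1, 0, one_ne_zero, by simp⟩ fun i _ => ?_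
  · rintro _ _ ⟨a, M, ha, rfl⟩ ⟨b, N, hb, rfl⟩
    refine ⟨a * b, M + N, mul_ne_zero ha hb, ?_⟩
    rw [Multiset.map_add, Multiset.prod_add, C_mul]
    ring
  · obtain ⟨c, l, hc, h⟩ := exists_eq_C_mul_linForm (hα i).1 (hα i).2.1
    refine ⟨c ^ m i, Multiset.replicate (m i) l, pow_ne_zero _ hc, ?_⟩
    rw [h, mul_pow, Multiset.map_replicate, Multiset.prod_replicate, C_pow]

theorem emultiplicity_linForm_prod [DecidableEq Line] {a : ℂ} (ha : a ≠ 0) (M : Multiset Line)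
    (l : Line) : emultiplicity (linForm l) (C a * (M.map linForm).prod) = M.count l := by
  rw [emultiplicity_mul (prime_linForm l), emultiplicity_of_isUnit_right (prime_linForm l).not_isUnit
    ((isUnit_iff_ne_zero.2 ha).map C), zero_add]
  induction M using Multiset.induction with
  | empty => simpa using emultiplicity_of_one_right (prime_linForm l).not_isUnit
  | cons m M ih =>
    rw [Multiset.map_cons, Multiset.prod_cons, emultiplicity_mul (prime_linForm l), ih,
      Multiset.count_cons, Nat.cast_add, add_comm]
    congr 1
    split_ifs with h
    · subst h
      simpa using (FiniteMultiplicity.of_prime_left (prime_linForm l)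
        (linForm_ne_zero l)).emultiplicity_self
    · simpa using emultiplicity_eq_zero.2 (mt linForm_dvd_linForm.1 h)

theorem isHomogeneous_prod_linForm (M : Multiset Line) :
    ((M.map linForm).prod).IsHomogeneous M.card := by
  induction M using Multiset.induction with
  | empty => simpa using isHomogeneous_one (Fin 3) ℂ
  | cons m M ih =>
    rw [Multiset.map_cons, Multiset.prod_cons, Multiset.card_cons, add_comm]
    exact (isHomogeneous_linForm m).mul ih

/-- The factorization of a completely reducible form into powers of distinct linear forms. -/
theorem IsCompletelyReducible.exists_factorization {F : MvPolynomial (Fin 3) ℂ} {d : ℕ}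
    (h : IsCompletelyReducible F) (hd : F.IsHomogeneous d) :
    ∃ (a : ℂ) (T : Finset Line), a ≠ 0 ∧ (∀ l, l ∈ T ↔ linForm l ∣ F) ∧
      F = C a * ∏ l ∈ T, linForm l ^ multiplicity (linForm l) F ∧
      ∑ l ∈ T, multiplicity (linForm l) F = d := by
  classical
  obtain ⟨a, M, ha, rfl⟩ := h.exists_multiset
  have hm : ∀ l, multiplicity (linForm l) (C a * (M.map linForm).prod) = M.count l := fun l =>
    multiplicity_eq_of_emultiplicity_eq_some (emultiplicity_linForm_prod ha M l)
  refine ⟨a, M.toFinset, ha, fun l => ?_, ?_, ?_⟩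
  · rw [Multiset.mem_toFinset, ← Multiset.count_ne_zero, ← hm, not_iff_comm,
      ← emultiplicity_eq_zero, emultiplicity_eq_zero_iff_multiplicity_eq_zero]
  · simp only [hm]
    rw [Finset.prod_multiset_map_count]
  · simp only [hm]
    rw [Multiset.toFinset_sum_count_eq]
    have h0 : C a * (M.map linForm).prod ≠ 0 := by
      refine mul_ne_zero (by simpa using ha) (Multiset.prod_ne_zero ?_)
      simp [linForm_ne_zero]
    exact ((isHomogeneous_prod_linForm M).C_mul a).inj_right hd h0

namespace Pencil

variable {d : ℕ} (P : Pencil d)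

/-! ### Fibers of a pencil -/

theorem fiber_mem (t : P.Param) : P.fiber t ∈ P.space := (t.rep : P.space).2

theorem fiber_ne_zero (t : P.Param) : P.fiber t ≠ 0 := fun h =>
  t.rep_nonzero (Subtype.ext h)

theorem isHomogeneous_fiber (t : P.Param) : (P.fiber t).IsHomogeneous d :=
  P.homogeneous (P.fiber_mem t)

variable {P}

theorem exists_eq_add_of_mem_space {s t : P.Param} (h : s ≠ t) {F : MvPolynomial (Fin 3) ℂ}
    (hF : F ∈ P.space) : ∃ a b : ℂ, F = C a * P.fiber s + C b * P.fiber t := by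
  have hli : LinearIndependent ℂ ![s.rep, t.rep] := by
    have := Projectivization.independent_iff.1 ((Projectivization.independent_pair_iff_ne s t).2 h)
    have e : ![s.rep, t.rep] = Projectivization.rep ∘ ![s, t] := by
      ext i
      fin_cases i <;> rfl
    rwa [e]
  have := FiniteDimensional.of_finrank_eq_succ P.finrank_space
  have hspan := hli.span_eq_top_of_card_eq_finrank' (by simp [P.finrank_space])
  have hmem : (⟨F, hF⟩ : P.space) ∈ Submodule.span ℂ (Set.range ![s.rep, t.rep]) := by
    rw [hspan]; trivial
  rw [Matrix.range_cons, Matrix.range_cons, Matrix.range_empty, Set.union_empty,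
    Set.singleton_union, Submodule.mem_span_pair] at hmem
  obtain ⟨a, b, hab⟩ := hmem
  refine ⟨a, b, ?_⟩
  simpa [smul_eq_C_mul, fiber] using (congrArg Subtype.val hab).symm

theorem eq_of_fiber_eq_C_mul {s t : P.Param} {c : ℂ} (h : P.fiber s = C c * P.fiber t) :
    s = t := by
  by_contra hst
  have := (Projectivization.independent_iff.1
    ((Projectivization.independent_pair_iff_ne s t).2 hst))
  have e : Projectivization.rep ∘ ![s, t] = ![s.rep, t.rep] := by
    ext i
    fin_cases i <;> rfl
  rw [e, LinearIndependent.pair_iff] at this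
  have h1 := this 1 (-c) (Subtype.ext (by
    have h2 : P.fiber s - C c * P.fiber t = 0 := sub_eq_zero.2 h
    rw [← smul_eq_C_mul] at h2
    simpa [fiber, sub_eq_add_neg] using h2))
  exact one_ne_zero h1.1

theorem exists_fiber_eq_add {r s t : P.Param} (hrs : r ≠ s) (hrt : r ≠ t) (hst : s ≠ t) :
    ∃ a b : ℂ, a ≠ 0 ∧ b ≠ 0 ∧ P.fiber r = C a * P.fiber s + C b * P.fiber t := by
  obtain ⟨a, b, h⟩ := exists_eq_add_of_mem_space hst (P.fiber_mem r)
  refine ⟨a, b, ?_, ?_, h⟩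
  · rintro rfl
    exact hrt (eq_of_fiber_eq_C_mul (c := b) (by simpa using h))
  · rintro rfl
    exact hrs (eq_of_fiber_eq_C_mul (c := a) (by simpa using h))

theorem eval_fiber_of_mem_base {p : Point} (hp : p ∈ P.base) (t : P.Param) :
    eval p.rep (P.fiber t) = 0 := hp _ (P.fiber_mem t)

/-- Two distinct fibers span the pencil. -/
theorem mem_base_of_eval_eq_zero {s t : P.Param} (h : s ≠ t) {p : Point}
    (hs : eval p.rep (P.fiber s) = 0) (ht : eval p.rep (P.fiber t) = 0) : p ∈ P.base := by
  intro F hF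
  obtain ⟨a, b, rfl⟩ := exists_eq_add_of_mem_space h hF
  simp [zeroLocus, hs, ht]

theorem mem_base_of_mem_linePoints {s t : P.Param} (h : s ≠ t) {l m : Line}
    (hl : l ∈ P.fiberLines s) (hm : m ∈ P.fiberLines t) {p : Point} (hpl : p ∈ linePoints l)
    (hpm : p ∈ linePoints m) : p ∈ P.base :=
  mem_base_of_eval_eq_zero h (eval_eq_zero_of_linForm_dvd hl hpl)
    (eval_eq_zero_of_linForm_dvd hm hpm)

variable (P) in
theorem exists_mem_linePoints_notMem_base (l : Line) : ∃ p ∈ linePoints l, p ∉ P.base :=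
  exists_mem_linePoints_notMem l P.finite_base

/-- A common component would put all its infinitely many points in the finite base. -/
theorem disjoint_fiberLines {s t : P.Param} (h : s ≠ t) :
    Disjoint (P.fiberLines s) (P.fiberLines t) := by
  rw [Set.disjoint_left]
  intro l hs ht
  obtain ⟨p, hp, hpX⟩ := P.exists_mem_linePoints_notMem_base l
  exact hpX (mem_base_of_mem_linePoints h hs ht hp hp)

theorem finite_fiberLines {t : P.Param} (ht : t ∈ P.reducibleFibers) :
    (P.fiberLines t).Finite := by
  obtain ⟨a, T, -, hT, -⟩ := IsCompletelyReducible.exists_factorization ht (P.isHomogeneous_fiber t)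
  exact T.finite_toSet.subset fun l hl => (hT l).2 hl

theorem degree_pos (P : Pencil d) : 0 < d := by
  rcases Nat.eq_zero_or_pos d with rfl | h
  · exfalso
    have h2 := P.homogeneous
    rw [homogeneousSubmodule_zero, Submodule.one_eq_span] at h2
    have h1 := (Submodule.finrank_mono h2).trans (finrank_span_le_card _)
    simp [P.finrank_space] at h1
  · exact h

/-- A nonunit factor of a completely reducible fiber is divisible by one of its lines. -/
theorem exists_linForm_dvd {t : P.Param} (ht : t ∈ P.reducibleFibers)
    {H : MvPolynomial (Fin 3) ℂ} (hH : H ∣ P.fiber t) (h0 : eval 0 H = 0) :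
    ∃ l ∈ P.fiberLines t, linForm l ∣ H := by
  obtain ⟨a, M, ha, hM⟩ := IsCompletelyReducible.exists_multiset ht
  -- Vanishing at the origin serves as the test for being a nonunit.
  have hu : ¬ IsUnit H := fun h => (h.map (eval (0 : Fin 3 → ℂ))).ne_zero h0
  have hne : H ≠ 0 := ne_zero_of_dvd_ne_zero (P.fiber_ne_zero t) hH
  obtain ⟨q, hq, hqH⟩ := WfDvdMonoid.exists_irreducible_factor hu hne
  have hqp := irreducible_iff_prime.1 hq
  have h1 := hqH.trans hH
  rw [hM] at h1
  rcases hqp.dvd_or_dvd h1 with h | h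
  · exact absurd (isUnit_of_dvd_unit h ((isUnit_iff_ne_zero.2 ha).map C)) hq.not_isUnit
  · obtain ⟨m, hm, hqm⟩ := hqp.exists_mem_multiset_map_dvd h
    have := (hq.associated_of_dvd (prime_linForm m).irreducible hqm).symm.dvd.trans hqH
    exact ⟨m, this.trans hH, this⟩

theorem eval_zero_fiber (t : P.Param) : eval 0 (P.fiber t) = 0 := by
  have := (P.isHomogeneous_fiber t).coeff_eq_zero (d := 0) (by simpa using P.degree_pos.ne)
  rwa [← constantCoeff_eq, ← eval_zero] at this

theorem fiberLines_nonempty {t : P.Param} (ht : t ∈ P.reducibleFibers) :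
    (P.fiberLines t).Nonempty :=
  let ⟨l, hl, _⟩ := exists_linForm_dvd ht dvd_rfl (eval_zero_fiber t)
  ⟨l, hl⟩

theorem exists_mem_fiberLines_of_eval_eq_zero {t : P.Param} (ht : t ∈ P.reducibleFibers)
    {p : Point} (hp : eval p.rep (P.fiber t) = 0) : ∃ l ∈ P.fiberLines t, p ∈ linePoints l := by
  obtain ⟨a, M, ha, hM⟩ := IsCompletelyReducible.exists_multiset ht
  rw [hM, map_mul, eval_C, map_multiset_prod, mul_eq_zero, Multiset.prod_eq_zero_iff] at hp
  have := hp.resolve_left ha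
  rw [Multiset.map_map, Multiset.mem_map] at this
  obtain ⟨l, hl, h⟩ := this
  refine ⟨l, ?_, (mem_linePoints_iff_eval p l).2 h⟩
  change linForm l ∣ P.fiber t
  rw [hM]
  exact (Multiset.dvd_prod (Multiset.mem_map_of_mem _ hl)).mul_left _

/-! ### Multiplicities of the fibers at a base point -/

/-- The restriction of a form to the parametrized affine line `x + s y`. -/
def restrictLine (x y : Fin 3 → ℂ) : MvPolynomial (Fin 3) ℂ →ₐ[ℂ] Polynomial ℂ :=
  aeval fun i => Polynomial.C (x i) + Polynomial.X * Polynomial.C (y i)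

theorem restrictLine_C (x y : Fin 3 → ℂ) (a : ℂ) : restrictLine x y (C a) = Polynomial.C a := by
  simp [restrictLine, Polynomial.C_eq_algebraMap]

theorem restrictLine_linForm (x y : Fin 3 → ℂ) (l : Line) :
    restrictLine x y (linForm l) =
      Polynomial.C (x ⬝ᵥ l.rep) + Polynomial.X * Polynomial.C (y ⬝ᵥ l.rep) := by
  simp only [linForm, map_sum, map_mul, restrictLine_C, dotProduct, Finset.mul_sum,
    ← Finset.sum_add_distrib]
  refine Finset.sum_congr rfl fun i _ => ?_
  simp [restrictLine]
  ring

-- The restriction is the value at `p` plus `X` times the value at `q`; the hypothesis says that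
-- these are not both zero.
open Classical in
theorem emultiplicity_X_restrictLine_linForm (p q : Point) {l : Line}
    (h : ¬ (p ∈ linePoints l ∧ q ∈ linePoints l)) :
    emultiplicity Polynomial.X (restrictLine p.rep q.rep (linForm l)) =
      if p ∈ linePoints l then 1 else 0 := by
  rw [restrictLine_linForm]
  split_ifs with hp
  · have hq : q.rep ⬝ᵥ l.rep ≠ 0 := fun hq =>
      h ⟨hp, (mem_linePoints_iff_dotProduct q l).2 hq⟩
    rw [(mem_linePoints_iff_dotProduct p l).1 hp, map_zero, zero_add,
      emultiplicity_mul Polynomial.prime_X, emultiplicity_of_isUnit_right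
        Polynomial.prime_X.not_isUnit (Polynomial.isUnit_C.2 (isUnit_iff_ne_zero.2 hq)), add_zero]
    simpa using (FiniteMultiplicity.of_prime_left (Polynomial.prime_X (R := ℂ))
        Polynomial.X_ne_zero).emultiplicity_self
  · rw [emultiplicity_eq_zero, Polynomial.X_dvd_iff]
    simpa using mt (mem_linePoints_iff_dotProduct p l).2 hp

open Classical in
/-- The multiplicity of a completely reducible fiber at a point `p` is the order of vanishing at `p`
of its restriction to a line through `p` that meets the components through `p` only in `p`. -/
theorem emultiplicity_X_restrictLine_fiber {t : P.Param} (ht : t ∈ P.reducibleFibers)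
    {p q : Point} (h : ∀ l ∈ P.fiberLines t, ¬ (p ∈ linePoints l ∧ q ∈ linePoints l)) :
    emultiplicity Polynomial.X (restrictLine p.rep q.rep (P.fiber t)) =
      (∑ᶠ l ∈ {l ∈ P.fiberLines t | p ∈ linePoints l},
        multiplicity (linForm l) (P.fiber t) : ℕ) := by
  obtain ⟨a, T, ha, hT, hF, -⟩ :=
    IsCompletelyReducible.exists_factorization ht (P.isHomogeneous_fiber t)
  have hset : {l ∈ P.fiberLines t | p ∈ linePoints l} =
      ((T.filter fun l => p ∈ linePoints l : Finset Line) : Set Line) := by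
    ext l
    simp [fiberLines, hT]
  rw [hset, finsum_mem_coe_finset]
  conv_lhs => rw [hF]
  rw [map_mul, restrictLine_C, map_prod, emultiplicity_mul Polynomial.prime_X,
    emultiplicity_of_isUnit_right Polynomial.prime_X.not_isUnit
      (Polynomial.isUnit_C.2 (isUnit_iff_ne_zero.2 ha)), zero_add,
    Finset.emultiplicity_prod Polynomial.prime_X, Finset.sum_filter, Nat.cast_sum]
  refine Finset.sum_congr rfl fun l hl => ?_
  rw [map_pow, emultiplicity_pow Polynomial.prime_X,
    emultiplicity_X_restrictLine_linForm p q (h l ((hT l).1 hl))]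
  split_ifs <;> simp

theorem multiplicity_eq_at_base {r s t : P.Param} (hr : r ∈ P.reducibleFibers)
    (hs : s ∈ P.reducibleFibers) (ht : t ∈ P.reducibleFibers)
    (hrs : r ≠ s) (hrt : r ≠ t) (hst : s ≠ t) {p : Point} (hp : p ∈ P.base) :
    ∑ᶠ l ∈ {l ∈ P.fiberLines s | p ∈ linePoints l}, multiplicity (linForm l) (P.fiber s) =
      ∑ᶠ l ∈ {l ∈ P.fiberLines t | p ∈ linePoints l}, multiplicity (linForm l) (P.fiber t) := by
  obtain ⟨l, hl, hpl⟩ := exists_mem_fiberLines_of_eval_eq_zero hr (eval_fiber_of_mem_base hp r)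
  obtain ⟨q, hql, hqp⟩ := (infinite_linePoints l).nontrivial.exists_ne p
  -- The line `l = pq` belongs to fiber `r`, hence is not a component of any other fiber.
  have key : ∀ u, r ≠ u → ∀ m ∈ P.fiberLines u, ¬ (p ∈ linePoints m ∧ q ∈ linePoints m) := by
    rintro u hu m hm ⟨hpm, hqm⟩
    have := (eq_or_eq_of_mem_linePoints hqm hpm hql hpl).resolve_left hqp
    subst this
    exact Set.disjoint_left.1 (disjoint_fiberLines hu) hl hm
  obtain ⟨a, b, ha, hb, hab⟩ := exists_fiber_eq_add hrs hrt hst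
  have h0 : restrictLine p.rep q.rep (P.fiber r) = 0 := by
    obtain ⟨G, hG⟩ : linForm l ∣ P.fiber r := hl
    rw [hG, map_mul, restrictLine_linForm, (mem_linePoints_iff_dotProduct p l).1 hpl,
      (mem_linePoints_iff_dotProduct q l).1 hql]
    simp
  rw [hab, map_add, map_mul, map_mul, restrictLine_C, restrictLine_C, add_eq_zero_iff_eq_neg] at h0
  have h1 := congrArg (emultiplicity Polynomial.X) h0
  rw [emultiplicity_neg, emultiplicity_mul Polynomial.prime_X,
    emultiplicity_mul Polynomial.prime_X,
    emultiplicity_of_isUnit_right Polynomial.prime_X.not_isUnit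
      (Polynomial.isUnit_C.2 (isUnit_iff_ne_zero.2 ha)),
    emultiplicity_of_isUnit_right Polynomial.prime_X.not_isUnit
      (Polynomial.isUnit_C.2 (isUnit_iff_ne_zero.2 hb)), zero_add, zero_add,
    emultiplicity_X_restrictLine_fiber hs (key s hrs),
    emultiplicity_X_restrictLine_fiber ht (key t hrt)] at h1
  exact_mod_cast h1

end Pencil

/-! ### Closed subsets of the plane and proper transforms of lines -/

theorem isClosed_iff_preimage_mk' {Z : Set Point} :
    IsClosed Z ↔ IsClosed (Projectivization.mk' ℂ ⁻¹' Z) := isClosed_coinduced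

theorem isClosed_linePoints (l : Line) : IsClosed (linePoints l) := by
  rw [isClosed_iff_preimage_mk']
  have : Projectivization.mk' ℂ ⁻¹' linePoints l =
      {v : {v : Fin 3 → ℂ // v ≠ 0} | (v : Fin 3 → ℂ) ⬝ᵥ l.rep = 0} := by
    ext v
    change Projectivization.orthogonal (Projectivization.mk ℂ v.1 v.2) l ↔ _
    conv_lhs => rw [← l.mk_rep]
    exact Projectivization.orthogonal_mk _ _
  rw [this]
  refine isClosed_eq (continuous_finsetSum _ fun i _ => ?_) continuous_const
  exact ((continuous_apply i).comp continuous_subtype_val).mul continuous_const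

/-- Proportionality to a fixed vector is the vanishing of a cross product, a closed condition. -/
theorem isClosed_singleton_line (l : Line) : IsClosed ({l} : Set Line) := by
  rw [isClosed_iff_preimage_mk']
  have : Projectivization.mk' ℂ ⁻¹' {l} =
      {v : {v : Fin 3 → ℂ // v ≠ 0} | crossProduct (v : Fin 3 → ℂ) l.rep = 0} := by
    ext v
    change Projectivization.mk ℂ v.1 v.2 = l ↔ _
    conv_lhs => rw [← l.mk_rep]
    exact Projectivization.mk_eq_mk_iff_crossProduct_eq_zero _ _
  rw [this]
  refine isClosed_eq ?_ continuous_const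
  exact ((crossProduct.flip l.rep).continuous_of_finiteDimensional).comp continuous_subtype_val

/-- The points `s` of the blow-up that lie over `l` and, over a blown-up point of `l`, in the
direction of `l`. -/
def lineTransform (X : Set Point) (l : Line) : Set (Point × (X → Line)) :=
  {s | s.1 ∈ linePoints l ∧ ∀ p : X, (p : Point) ∈ linePoints l → s.2 p = l}

theorem isClosed_lineTransform (X : Set Point) (l : Line) : IsClosed (lineTransform X l) := by
  have : lineTransform X l = Prod.fst ⁻¹' linePoints l ∩
      ⋂ p : X, ⋂ _ : (p : Point) ∈ linePoints l, (fun s : Point × (X → Line) => s.2 p) ⁻¹' {l} := by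
    ext s
    simp [lineTransform]
  rw [this]
  refine ((isClosed_linePoints l).preimage continuous_fst).inter ?_
  exact isClosed_iInter fun p => isClosed_iInter fun _ =>
    (isClosed_singleton_line l).preimage ((continuous_apply p).comp continuous_snd)

/-- Off `X`, the line attached to a blown-up `p` on `l` joins the distinct points `s.1` and `p` of
`l`, so it is `l`. -/
theorem mem_lineTransform {X : Set Point} {s : Point × (X → Line)} (hs : s ∈ blowUp X)
    (hX : s.1 ∉ X) {l : Line} (hl : s.1 ∈ linePoints l) : s ∈ lineTransform X l := by
  refine ⟨hl, fun p hp => ?_⟩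
  refine (eq_or_eq_of_mem_linePoints (hs p).1 (hs p).2 hl hp).resolve_left ?_
  intro h
  exact hX (h ▸ p.2)

/-- Over a common point, which lies in `X`, the attached direction would have to be both `l` and
`m`. -/
theorem disjoint_lineTransform {X : Set Point} {l m : Line} (hlm : l ≠ m)
    (h : ∀ p, p ∈ linePoints l → p ∈ linePoints m → p ∈ X) :
    Disjoint (lineTransform X l) (lineTransform X m) := by
  rw [Set.disjoint_left]
  rintro s ⟨h1, h2⟩ ⟨h3, h4⟩
  have hX := h _ h1 h3
  exact hlm ((h2 ⟨_, hX⟩ h1).symm.trans (h4 ⟨_, hX⟩ h3))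

theorem exists_mem_blowUp {X : Set Point} {q : Point} (hq : q ∉ X) :
    ∃ s ∈ blowUp X, s.1 = q := by
  classical
  refine ⟨(q, fun p => Projectivization.cross q p), fun p => ?_, rfl⟩
  have : q ≠ p := fun h => hq (h ▸ p.2)
  exact ⟨Projectivization.orthogonal_cross_left this, Projectivization.orthogonal_cross_right this⟩

namespace Pencil

variable {d : ℕ} {P : Pencil d}

/-- In a connected completely reducible fiber, a nonempty set of components that is closed under
meeting outside the base consists of all the components. -/
theorem fiberLines_subset_of_isConnected {t : P.Param} (ht : t ∈ P.reducibleFibers)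
    (hc : IsConnected (properTransform P.base (P.fiber t))) {A : Set Line}
    (hA : A ⊆ P.fiberLines t) (hne : A.Nonempty)
    (hstep : ∀ l ∈ A, ∀ m ∈ P.fiberLines t, ∀ p, p ∈ linePoints l → p ∈ linePoints m →
      p ∉ P.base → m ∈ A) : P.fiberLines t ⊆ A := by
  by_contra hsub
  obtain ⟨m, hm, hmA⟩ := Set.not_subset.1 hsub
  have hfin := finite_fiberLines ht
  let U : Set Line → Set (Point × (P.base → Line)) := fun B => ⋃ l ∈ B, lineTransform P.base l
  have hU : ∀ B ⊆ P.fiberLines t, IsClosed (U B) := fun B hB =>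
    (hfin.subset hB).isClosed_biUnion fun l _ => isClosed_lineTransform _ l
  have hB : P.fiberLines t \ A ⊆ P.fiberLines t := Set.sdiff_subset
  have hcover : properTransform P.base (P.fiber t) ⊆ U A ∪ U (P.fiberLines t \ A) := by
    refine closure_minimal ?_ ((hU A hA).union (hU _ hB))
    rintro s ⟨hs, hsX, hsF⟩
    obtain ⟨l, hl, hsl⟩ := exists_mem_fiberLines_of_eval_eq_zero ht hsF
    have hmem := mem_lineTransform hs hsX hsl
    by_cases hlA : l ∈ A
    · exact Or.inl (Set.mem_biUnion hlA hmem)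
    · exact Or.inr (Set.mem_biUnion (show l ∈ P.fiberLines t \ A from ⟨hl, hlA⟩) hmem)
  have hmeet : ∀ B ⊆ P.fiberLines t, B.Nonempty →
      (properTransform P.base (P.fiber t) ∩ U B).Nonempty := by
    rintro B hB ⟨l, hl⟩
    obtain ⟨p, hpl, hpX⟩ := P.exists_mem_linePoints_notMem_base l
    obtain ⟨s, hs, rfl⟩ := exists_mem_blowUp hpX
    exact ⟨s, subset_closure ⟨hs, hpX, eval_eq_zero_of_linForm_dvd (hB hl) hpl⟩,
      Set.mem_biUnion hl (mem_lineTransform hs hpX hpl)⟩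
  -- Two closed sets that cover the connected proper transform and both meet it have a common point
  -- in it.
  obtain ⟨s, -, hsA, hsB⟩ := isPreconnected_closed_iff.1 hc.isPreconnected _ _ (hU A hA) (hU _ hB)
    hcover (hmeet A hA hne) (hmeet _ hB ⟨m, hm, hmA⟩)
  obtain ⟨l, hl, hsl⟩ := Set.mem_iUnion₂.1 hsA
  obtain ⟨l', hl', hsl'⟩ := Set.mem_iUnion₂.1 hsB
  refine Set.disjoint_left.1 (disjoint_lineTransform (fun h : l = l' => hl'.2 (h ▸ hl))
    fun p hp hp' => ?_) hsl hsl'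
  by_contra hpX
  exact hl'.2 (hstep l hl l' hl'.1 p hp hp' hpX)

theorem reflTransGen_of_isConnected {t : P.Param} (ht : t ∈ P.reducibleFibers)
    (hc : IsConnected (properTransform P.base (P.fiber t))) {l m : Line}
    (hl : l ∈ P.fiberLines t) (hm : m ∈ P.fiberLines t) :
    Relation.ReflTransGen (fun a b => b ∈ P.fiberLines t ∧
      ∃ p, p ∈ linePoints a ∧ p ∈ linePoints b ∧ p ∉ P.base) l m := by
  have := fiberLines_subset_of_isConnected ht hc
    (A := {m | m ∈ P.fiberLines t ∧ Relation.ReflTransGen (fun a b => b ∈ P.fiberLines t ∧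
      ∃ p, p ∈ linePoints a ∧ p ∈ linePoints b ∧ p ∉ P.base) l m})
    (fun _ h => h.1) ⟨l, hl, .refl⟩
    fun a ha b hb p hpa hpb hpX => ⟨hb, ha.2.tail ⟨hb, p, hpa, hpb, hpX⟩⟩
  exact (this hm).2

/-! ### The multiplicities are relatively prime -/

/-- The multiplicities in two fibers of a pencil have no common divisor as soon as a third fiber
is completely reducible and connected. -/
theorem eq_one_of_dvd_multiplicity {r s t : P.Param} (hr : r ∈ P.reducibleFibers)
    (hs : s ∈ P.reducibleFibers) (ht : t ∈ P.reducibleFibers)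
    (hrs : r ≠ s) (hrt : r ≠ t) (hst : s ≠ t)
    (hc : IsConnected (properTransform P.base (P.fiber r))) {c : ℕ}
    (hcs : ∀ l ∈ P.fiberLines s, c ∣ multiplicity (linForm l) (P.fiber s))
    (hct : ∀ l ∈ P.fiberLines t, c ∣ multiplicity (linForm l) (P.fiber t)) : c = 1 := by
  have hc0 : c ≠ 0 := by
    rintro rfl
    obtain ⟨l, hl⟩ := fiberLines_nonempty hs
    exact (multiplicity_pos_of_dvd hl).ne' (zero_dvd_iff.1 (hcs l hl))
  by_contra hc1
  -- Over `ℂ` the scalar also has a `c`-th root.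
  have hpow : ∀ u ∈ P.reducibleFibers,
      (∀ l ∈ P.fiberLines u, c ∣ multiplicity (linForm l) (P.fiber u)) → ∀ b : ℂ,
      ∃ G, C b * P.fiber u = G ^ c := by
    intro u hu hcu b
    obtain ⟨a, T, -, hT, hF, -⟩ :=
      IsCompletelyReducible.exists_factorization hu (P.isHomogeneous_fiber u)
    obtain ⟨z, hz⟩ := IsAlgClosed.exists_pow_nat_eq (b * a) (Nat.pos_of_ne_zero hc0)
    refine ⟨C z * ∏ l ∈ T, linForm l ^ (multiplicity (linForm l) (P.fiber u) / c), ?_⟩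
    rw [mul_pow, ← C_pow, hz, ← Finset.prod_pow, C_mul, mul_assoc]
    conv_lhs => rw [hF]
    congr 2
    refine Finset.prod_congr rfl fun l hl => ?_
    rw [← pow_mul, Nat.div_mul_cancel (hcu l ((hT l).1 hl))]
  obtain ⟨a, b, ha, hb, hab⟩ := exists_fiber_eq_add hrs hrt hst
  obtain ⟨x, hx⟩ := hpow s hs hcs a
  obtain ⟨y, hy⟩ := hpow t ht hct (-b)
  have hfac : (∑ i ∈ Finset.range c, x ^ i * y ^ (c - 1 - i)) * (x - y) = P.fiber r := by
    rw [Commute.geom_sum₂_mul (Commute.all x y), ← hx, ← hy, hab, C_neg]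
    ring
  set K := ∑ i ∈ Finset.range c, x ^ i * y ^ (c - 1 - i) with hK
  -- All terms of `K` have total exponent `c - 1`, which is positive because `c ≠ 1`.
  have hzero : ∀ v, eval v x = 0 → eval v y = 0 → eval v K = 0 := by
    intro v h1 h2
    simp only [hK, map_sum, map_mul, map_pow, h1, h2, ← pow_add]
    refine Finset.sum_eq_zero fun i hi => zero_pow ?_
    have := Finset.mem_range.1 hi
    omega
  have hx0 : ∀ v, eval v x = 0 ↔ eval v (P.fiber s) = 0 := fun v => by
    rw [← pow_eq_zero_iff hc0, ← map_pow, ← hx, map_mul, eval_C]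
    simp [ha]
  have hy0 : ∀ v, eval v y = 0 ↔ eval v (P.fiber t) = 0 := fun v => by
    rw [← pow_eq_zero_iff hc0, ← map_pow, ← hy, map_mul, eval_C]
    simp [hb]
  -- Where `x = y`, the cofactor `K` equals `c * y ^ (c - 1)`, so `x` and `y` both vanish.
  have hmeet : ∀ p : Point, eval p.rep (x - y) = 0 → eval p.rep K = 0 → p ∈ P.base := by
    intro p h1 h2
    rw [map_sub, sub_eq_zero] at h1
    have h3 : eval p.rep y = 0 := by
      simp only [hK, map_sum, map_mul, map_pow, h1, ← pow_add] at h2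
      rw [Finset.sum_congr rfl (g := fun _ => eval p.rep y ^ (c - 1)) fun i hi => by
        have := Finset.mem_range.1 hi
        congr 1
        omega] at h2
      rw [Finset.sum_const, Finset.card_range, nsmul_eq_mul, mul_eq_zero] at h2
      exact pow_eq_zero_iff (by omega) |>.1 (h2.resolve_left (by exact_mod_cast hc0))
    exact mem_base_of_eval_eq_zero hst ((hx0 _).1 (h1.trans h3)) ((hy0 _).1 h3)
  have hx00 := (hx0 0).2 (eval_zero_fiber s)
  have hy00 := (hy0 0).2 (eval_zero_fiber t)
  obtain ⟨l, hl, hlH⟩ := exists_linForm_dvd hr (H := x - y) ⟨K, by rw [← hfac, mul_comm]⟩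
    (by rw [map_sub, hx00, hy00, sub_zero])
  obtain ⟨m, hm, hmK⟩ := exists_linForm_dvd hr (H := K) ⟨x - y, hfac.symm⟩
    (hzero 0 hx00 hy00)
  have hsub := fiberLines_subset_of_isConnected hr hc
    (A := {l | l ∈ P.fiberLines r ∧ linForm l ∣ x - y}) (fun _ h => h.1) ⟨l, hl, hlH⟩
    fun a ha b hb p hpa hpb hpX => by
      refine ⟨hb, ?_⟩
      have hb' : linForm b ∣ P.fiber r := hb
      rw [← hfac] at hb'
      refine ((prime_linForm b).dvd_or_dvd hb').resolve_left fun hbK => hpX ?_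
      exact hmeet p (eval_eq_zero_of_linForm_dvd ha.2 hpa) (eval_eq_zero_of_linForm_dvd hbK hpb)
  -- Now `m` divides both `K` and `x - y`, so all its points would be base points.
  obtain ⟨p, hp, hpX⟩ := P.exists_mem_linePoints_notMem_base m
  exact hpX (hmeet p (eval_eq_zero_of_linForm_dvd (hsub hm).2 hp)
    (eval_eq_zero_of_linForm_dvd hmK hp))

/-! ### Finiteness of the set of completely reducible fibers -/

theorem exists_mem_base_mem_linePoints {s t : P.Param} (ht : t ∈ P.reducibleFibers)
    (h : s ≠ t) {l : Line} (hl : l ∈ P.fiberLines s) : ∃ p ∈ P.base, p ∈ linePoints l := by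
  obtain ⟨m, hm⟩ := fiberLines_nonempty ht
  have hlm : l ≠ m := fun e => Set.disjoint_left.1 (disjoint_fiberLines h) hl (e ▸ hm)
  obtain ⟨p, hpl, hpm⟩ := exists_mem_linePoints_inter hlm
  exact ⟨p, mem_base_of_mem_linePoints h hl hm hpl hpm, hpl⟩

theorem finite_lines_nontrivial_base {X : Set Point} (hX : X.Finite) :
    {l : Line | (X ∩ linePoints l).Nontrivial}.Finite := by
  have : ∀ l : Line, (X ∩ linePoints l).Nontrivial →
      ∃ pq : Point × Point, (pq ∈ X ×ˢ X) ∧ pq.1 ≠ pq.2 ∧ pq.1 ∈ linePoints l ∧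
        pq.2 ∈ linePoints l := by
    rintro l ⟨p, hp, q, hq, hpq⟩
    exact ⟨(p, q), ⟨hp.1, hq.1⟩, hpq, hp.2, hq.2⟩
  choose! f hf using this
  refine Set.Finite.of_injOn (f := f) (fun l hl => (hf l hl).1) ?_ (hX.prod hX)
  intro l hl m hm h
  have h1 := (hf l hl).2
  have h2 := (hf m hm).2
  rw [← h] at h2
  exact (eq_or_eq_of_mem_linePoints h1.2.1 h1.2.2 h2.2.1 h2.2.2).resolve_left h1.1

/-- A connected completely reducible fiber whose components all meet the base in the same single
point has multiplicity divisible by the degree. -/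
theorem degree_dvd_multiplicity {t : P.Param} (ht : t ∈ P.reducibleFibers)
    (hc : IsConnected (properTransform P.base (P.fiber t))) {p : Point} (hp : p ∈ P.base)
    (hpl : ∀ l ∈ P.fiberLines t, p ∈ linePoints l) {l : Line} (hl : l ∈ P.fiberLines t) :
    d ∣ multiplicity (linForm l) (P.fiber t) := by
  -- Another component meets `l` only at the base point `p`, so `{l}` is closed under meeting
  -- outside the base.
  have hsub := fiberLines_subset_of_isConnected ht hc (A := {l}) (by simpa using hl) ⟨l, rfl⟩ (by
    rintro _ rfl m hm q hql hqm hqX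
    refine ((eq_or_eq_of_mem_linePoints hql (hpl _ hl) hqm (hpl m hm)).resolve_left ?_).symm
    rintro rfl
    exact hqX hp)
  obtain ⟨a, T, -, hT, -, hd⟩ :=
    IsCompletelyReducible.exists_factorization ht (P.isHomogeneous_fiber t)
  have hTl : T = {l} := Finset.eq_singleton_iff_unique_mem.2
    ⟨(hT l).2 hl, fun m hm => hsub ((hT m).1 hm)⟩
  rw [hTl, Finset.sum_singleton] at hd
  rw [hd]

theorem finite_reducibleFibers (hc : P.IsConnectedPencil) (hd : 2 ≤ d) :
    P.reducibleFibers.Finite := by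
  classical
  by_contra hinf
  have hbad := finite_lines_nontrivial_base P.finite_base
  -- Distinct fibers share no line, so choosing a line with two base points embeds these fibers in a
  -- finite set.
  have hbadt : {t : P.Param | t ∈ P.reducibleFibers ∧
      ∃ l ∈ P.fiberLines t, (P.base ∩ linePoints l).Nontrivial}.Finite := by
    have : ∀ t : P.Param, (t ∈ P.reducibleFibers ∧
      ∃ l ∈ P.fiberLines t, (P.base ∩ linePoints l).Nontrivial) → ∃ l ∈ P.fiberLines t,
        (P.base ∩ linePoints l).Nontrivial := fun t h => h.2
    choose! f hf using this
    refine Set.Finite.of_injOn (f := f) (fun t ht => (hf t ht).2) ?_ hbad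
    intro s hs t ht h
    by_contra hst
    exact Set.disjoint_left.1 (disjoint_fiberLines hst) (hf s hs).1 (h ▸ (hf t ht).1)
  obtain ⟨S, hS, hcard⟩ := (Set.Infinite.sdiff hinf hbadt).exists_subset_card_eq 3
  obtain ⟨r, s, t, hrs, hrt, hst, rfl⟩ := Finset.card_eq_three.1 hcard
  have hmem : ∀ u ∈ ({r, s, t} : Finset P.Param), u ∈ P.reducibleFibers ∧
      ∀ l ∈ P.fiberLines u, (P.base ∩ linePoints l).Subsingleton := fun u hu =>
    ⟨(hS hu).1, fun l hl => Set.not_nontrivial_iff.1 fun h => (hS hu).2 ⟨(hS hu).1, l, hl, h⟩⟩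
  obtain ⟨hr, hr1⟩ := hmem r (by simp)
  obtain ⟨hs, hs1⟩ := hmem s (by simp)
  obtain ⟨ht, ht1⟩ := hmem t (by simp)
  obtain ⟨l, hl⟩ := fiberLines_nonempty hr
  obtain ⟨p, hp, hpl⟩ := exists_mem_base_mem_linePoints hs hrs hl
  -- The intersection of `m` with `l` is a base point on `l`, and `p` is the only one.
  have key : ∀ u, r ≠ u → ∀ m ∈ P.fiberLines u, p ∈ linePoints m := by
    intro u hu m hm
    have hlm : l ≠ m := fun e => Set.disjoint_left.1 (disjoint_fiberLines hu) hl (e ▸ hm)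
    obtain ⟨q, hql, hqm⟩ := exists_mem_linePoints_inter hlm
    have := hr1 l hl ⟨hp, hpl⟩ ⟨mem_base_of_mem_linePoints hu hl hm hql hqm, hql⟩
    rwa [this]
  have := eq_one_of_dvd_multiplicity hr hs ht hrs hrt hst (hc r)
    (fun m hm => degree_dvd_multiplicity hs (hc s) hp (key s hrs) hm)
    (fun m hm => degree_dvd_multiplicity ht (hc t) hp (key t hrt) hm)
  omega

/-! ### The multinet of finitely many fibers -/

theorem sum_multiplicity_eq {S : Finset P.Param} {t : P.Param} (ht : t ∈ S) {l : Line}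
    (hl : l ∈ P.fiberLines t) :
    ∑ s ∈ S, multiplicity (linForm l) (P.fiber s) = multiplicity (linForm l) (P.fiber t) := by
  refine Finset.sum_eq_single_of_mem t ht fun s _ hst => ?_
  exact multiplicity_eq_zero.2 fun h => Set.disjoint_left.1 (disjoint_fiberLines hst) h hl

/-- The arrangement of the components of finitely many completely reducible fibers, with their
multiplicities in the fibers. -/
def arrangement (S : Finset P.Param) (hS : (S : Set P.Param) ⊆ P.reducibleFibers) :
    MultiArrangement where
  lines := ⋃ t ∈ S, P.fiberLines t
  finite_lines := S.finite_toSet.biUnion fun t ht => finite_fiberLines (hS ht)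
  -- At most one summand is nonzero; the sum avoids choosing the fiber that contains `l`.
  mult l := ∑ s ∈ S, multiplicity (linForm l) (P.fiber s)
  mult_pos l hl := by
    obtain ⟨t, ht, hl⟩ := Set.mem_iUnion₂.1 hl
    rw [sum_multiplicity_eq ht hl]
    exact multiplicity_pos_of_dvd hl

theorem arrangement_mult {S : Finset P.Param} {hS : (S : Set P.Param) ⊆ P.reducibleFibers}
    {t : P.Param} (ht : t ∈ S) {l : Line} (hl : l ∈ P.fiberLines t) :
    (arrangement S hS).mult l = multiplicity (linForm l) (P.fiber t) :=
  sum_multiplicity_eq ht hl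

theorem fiberLines_subset_arrangement {S : Finset P.Param}
    {hS : (S : Set P.Param) ⊆ P.reducibleFibers} {t : P.Param} (ht : t ∈ S) :
    P.fiberLines t ⊆ (arrangement S hS).lines :=
  Set.subset_biUnion_of_mem (u := fun t => P.fiberLines t) (show t ∈ (S : Set P.Param) from ht)

theorem three_le_encard_lines_through {S : Finset P.Param}
    {hS : (S : Set P.Param) ⊆ P.reducibleFibers} (hcard : 3 ≤ S.card) {p : Point}
    (hp : p ∈ P.base) :
    3 ≤ {l ∈ (arrangement S hS).lines | p ∈ linePoints l}.encard := by
  have : ∀ t : S, ∃ l ∈ P.fiberLines t, p ∈ linePoints l := fun t =>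
    exists_mem_fiberLines_of_eval_eq_zero (hS t.2) (eval_fiber_of_mem_base hp t)
  choose f hf hpf using this
  have hinj : Function.Injective f := fun s t h => by
    by_contra hst
    exact Set.disjoint_left.1 (disjoint_fiberLines (Subtype.coe_injective.ne hst)) (hf s)
      (h ▸ hf t)
  have hsub : Set.range f ⊆ {l ∈ (arrangement S hS).lines | p ∈ linePoints l} := by
    rintro _ ⟨t, rfl⟩
    exact ⟨fiberLines_subset_arrangement t.2 (hf t), hpf t⟩
  refine le_trans ?_ (Set.encard_le_encard hsub)
  rw [← Set.image_univ, hinj.encard_image, Set.encard_univ, ENat.card_eq_coe_fintype_card,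
    Fintype.card_coe]
  exact_mod_cast hcard

theorem isWeakMultinet_arrangement {S : Finset P.Param}
    {hS : (S : Set P.Param) ⊆ P.reducibleFibers} (hcard : 3 ≤ S.card) :
    IsWeakMultinet (arrangement S hS) S.card d (fun t : S => P.fiberLines t) P.base where
  card_classes := by simp
  three_le := hcard
  nonempty t := fiberLines_nonempty (hS t.2)
  disjoint _ _ h := disjoint_fiberLines (Subtype.coe_injective.ne h)
  union := by
    ext l
    simp [arrangement]
  multiple p hp := three_le_encard_lines_through hcard hp
  degree t := by
    obtain ⟨a, T, -, hT, -, hd⟩ :=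
      IsCompletelyReducible.exists_factorization (hS t.2) (P.isHomogeneous_fiber t)
    have hset : P.fiberLines t = T := Set.ext fun l => (hT l).symm
    refine (finsum_mem_congr hset fun l hl => arrangement_mult t.2 ((hT l).1 hl)).trans ?_
    rw [finsum_mem_coe_finset, hd]
  inter_mem _ _ h _ hl _ hm _ hpl hpm :=
    mem_base_of_mem_linePoints (Subtype.coe_injective.ne h) hl hm hpl hpm
  balanced p hp := by
    classical
    have hmult : ∀ t : S, ∑ᶠ l ∈ {l ∈ P.fiberLines t | p ∈ linePoints l},
        (arrangement S hS).mult l = ∑ᶠ l ∈ {l ∈ P.fiberLines t | p ∈ linePoints l},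
          multiplicity (linForm l) (P.fiber t) := fun t =>
      finsum_mem_congr rfl fun l hl => arrangement_mult t.2 hl.1
    obtain ⟨s, hs⟩ := Finset.card_pos.1 (show 0 < S.card by omega)
    refine ⟨∑ᶠ l ∈ {l ∈ P.fiberLines s | p ∈ linePoints l}, multiplicity (linForm l) (P.fiber s),
      fun t => (hmult t).trans ?_⟩
    by_cases hts : (t : P.Param) = s
    · rw [hts]
    -- Comparing two fibers needs a third one to restrict to.
    · obtain ⟨r, hr⟩ : ((S.erase s).erase t).Nonempty := by
        rw [← Finset.card_pos, Finset.card_erase_of_mem (Finset.mem_erase.2 ⟨hts, t.2⟩),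
          Finset.card_erase_of_mem hs]
        omega
      simp only [Finset.mem_erase] at hr
      exact multiplicity_eq_at_base (hS hr.2.2) (hS t.2) (hS hs) hr.1 hr.2.1 hts hp

end Pencil

end CevaPencil

end

theorem proposition3p6 {d : ℕ} (P : CevaPencil.Pencil d) (hP : P.IsCeva) :
    (2 ≤ d → P.reducibleFibers.Finite) ∧
    ∀ S : Finset P.Param, (S : Set P.Param) ⊆ P.reducibleFibers → 3 ≤ S.card →
      ∃ A : CevaPencil.MultiArrangement,
        A.lines = ⋃ t ∈ S, P.fiberLines t ∧
        (∀ t ∈ S, ∀ l ∈ P.fiberLines t,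
          emultiplicity (CevaPencil.linForm l) (P.fiber t) = A.mult l) ∧
        CevaPencil.IsMultinet A S.card d (fun t : S => P.fiberLines t) P.base ∧
        ∀ c : ℕ, (∀ l ∈ A.lines, c ∣ A.mult l) → c = 1 := by
  refine ⟨CevaPencil.Pencil.finite_reducibleFibers hP.1, fun S hS hcard =>
    ⟨CevaPencil.Pencil.arrangement S hS, rfl, fun t ht l hl => ?_,
      { toIsWeakMultinet := CevaPencil.Pencil.isWeakMultinet_arrangement hcard
        chain := fun t l hl m hm =>
          CevaPencil.Pencil.reflTransGen_of_isConnected (hS t.2) (hP.1 t) hl hm }, fun c hc => ?_⟩⟩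
  · rw [CevaPencil.Pencil.arrangement_mult ht hl]
    exact (FiniteMultiplicity.of_prime_left (CevaPencil.prime_linForm l)
      (P.fiber_ne_zero t)).emultiplicity_eq_multiplicity
  · obtain ⟨r, s, t, hr, hs, ht, hrs, hrt, hst⟩ :=
      Finset.two_lt_card_iff.1 (show 2 < S.card by omega)
    have hdvd : ∀ u ∈ S, ∀ l ∈ P.fiberLines u,
        c ∣ multiplicity (CevaPencil.linForm l) (P.fiber u) := fun u hu l hl => by
      rw [← CevaPencil.Pencil.arrangement_mult (hS := hS) hu hl]
      exact hc l (CevaPencil.Pencil.fiberLines_subset_arrangement hu hl)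
    exact CevaPencil.Pencil.eq_one_of_dvd_multiplicity (hS hr) (hS hs) (hS ht) hrs hrt hst
      (hP.1 r) (hdvd s hs) (hdvd t ht)
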